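/- Let $F$ be an infinite division ring of characteristic $p\ge 0$, let $r,r'\ge 1$ be (possibly infinite) cardinals, let $V$ be a left $F$-vector space of dimension $r+r'$, and let $G=\mathrm{GL}_F(V)$ be its group of $F$-linear automorphisms. Let $\mathrm{Gr}=\mathrm{Gr}((r,r'),V)$ be the set of $F$-subspaces of $V$ of dimension $r$ and codimension $r'$. For an associative unital ring $A$, let $A[\mathrm{Gr}]=A\otimes_{\mathbb Z}\mathbb Z[\mathrm{Gr}]$ be the group of finite formal combinations $\sum_j a_j[L_j]$ with $a_j\in A$, $L_j\in\mathrm{Gr}$, on which $G$ acts through its action on $\mathrm{Gr}$, and let $A[\mathrm{Gr}]^\circ=A\otimes_{\mathbb Z}\mathbb Z[\mathrm{Gr}]^\circ$ be the subgroup of those with $\sum_j a_j=0$. Then there is a descending sequence of nonzero $G$-submodules $M_0:=\mathbb Z[\mathrm{Gr}]^\circ\supseteq M_1\supseteq M_2\supseteq\cdots$ such that: 1. $M_0/M_1$ is a free abelian group, and it vanishes if and only if at least one of $r$ and $r'$ is finite; 2. if $p>0$, the natural map $\mathbb Z[1/p]\otimes_{\mathbb Z}M_n\to\mathbb Z[1/p]\otimes_{\mathbb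 Z}M_1$ is surjective for every $n\ge 1$; 3. for every $n\ge 1$ and every field $K$, the natural map $K\otimes_{\mathbb Z}M_n\to K\otimes_{\mathbb Z}M_1$ is surjective; 4. for every integer $N\ge 0$ there is an $n$ such that, for every associative unital ring $A$, all $a_0,\dots,a_N\in A$ and all $L_0,\dots,L_N\in\mathrm{Gr}$ with $L_0\not\subseteq\bigcup_{i=1}^N L_i$: every $G$-stable left $A$-submodule of $A\otimes M_0=A[\mathrm{Gr}]^\circ$ that contains $\sum_{i=0}^N a_i[L_i]$ contains (the image in $A\otimes M_0$ of) $Aa_0\otimes M_n$, and every $G$-stable right $A$-submodule of $A\otimes M_0$ that contains $\sum_{i=0}^N a_i[L_i]$ contains $a_0A\otimes M_n$. -/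

import Mathlib

open scoped TensorProduct

universe u v w

/-- `Gr(r, r'; V)`: the `F`-subspaces of `V` of dimension `r` and of codimension `r'`. -/
structure Gr (F : Type u) (V : Type v) [DivisionRing F] [AddCommGroup V] [Module F V]
    (r r' : Cardinal.{v}) where
  /-- the underlying subspace -/
  carrier : Submodule F V
  /-- its dimension is `r` -/
  rank_eq : Module.rank F carrier = r
  /-- its codimension is `r'` -/
  corank_eq : Module.rank F (V ⧸ carrier) = r'

namespace Gr

variable {F : Type u} {V : Type v} [DivisionRing F] [AddCommGroup V] [Module F V]
  {r r' : Cardinal.{v}}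

/-- The image `g(L)` of `L` under an automorphism `g` of `V`. -/
def translate (g : V ≃ₗ[F] V) (L : Gr F V r r') : Gr F V r r' where
  carrier := L.carrier.map (g : V →ₗ[F] V)
  rank_eq := (g.submoduleMap L.carrier).rank_eq.symm.trans L.rank_eq
  corank_eq :=
    (Submodule.Quotient.equiv L.carrier (L.carrier.map (g : V →ₗ[F] V)) g rfl).rank_eq.symm.trans
      L.corank_eq

/-- The action of `g ∈ GL_F(V)` on formal combinations: `∑ aⱼ [Lⱼ] ↦ ∑ aⱼ [g(Lⱼ)]`. Here `A[Gr]`,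
the finite formal combinations of points of `Gr` with coefficients in `A`, is `Gr →₀ A`. -/
noncomputable def act {A : Type w} [AddCommMonoid A] (g : V ≃ₗ[F] V) (x : Gr F V r r' →₀ A) :
    Gr F V r r' →₀ A :=
  x.mapDomain (translate g)

variable (F V r r') in
/-- `A[Gr]°`: the formal combinations `∑ aⱼ [Lⱼ]` with `∑ aⱼ = 0`, as an `R`-submodule of `A[Gr]`
(with `R = ℤ`, or `R = A` acting on `A` from the left, or `R = Aᵐᵒᵖ` acting from the right). -/
noncomputable def degreeZero (R : Type*) (A : Type w) [Semiring R] [AddCommMonoid A] [Module R A] :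
    Submodule R (Gr F V r r' →₀ A) :=
  LinearMap.ker (Finsupp.lsum ℕ fun _ : Gr F V r r' => (LinearMap.id : A →ₗ[R] A))

/-- An `R`-submodule of `A[Gr]` is `G`-stable if it is preserved by all `g ∈ G = GL_F(V)`. -/
def IsGStable {R : Type*} {A : Type w} [Semiring R] [AddCommMonoid A] [Module R A]
    (M : Submodule R (Gr F V r r' →₀ A)) : Prop :=
  ∀ (g : V ≃ₗ[F] V), ∀ x ∈ M, act g x ∈ M

/-- The pure tensor `a ⊗ m` as an element of `A ⊗ ℤ[Gr] = A[Gr]`: if `m = ∑ mⱼ [Lⱼ]` with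
integers `mⱼ`, it is `∑ (mⱼ a) [Lⱼ]`. -/
noncomputable def pure {A : Type w} [Ring A] (a : A) (m : Gr F V r r' →₀ ℤ) : Gr F V r r' →₀ A :=
  m.mapRange (fun k : ℤ => k • a) (zero_smul ℤ a)

end Gr

/-! Call two points of `Gr` adjacent when they are distinct and share a common hyperplane. Let
`adjSpan` be the span of all differences [L] - [L'] of adjacent points. The sequence is constant
from index 1 on: every M_n with n ≥ 1 is `adjSpan`. The surjectivity claims are then immediate, and
n = 1 serves for every N.

The main point is to extract a₀([L] - [L']) from a stable group containing ∑ aᵢ[Lᵢ]. Take v ≠ 0 in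
L₀ and in no other Lᵢ. Choose functionals ψᵢ with ψᵢ(v) = 1 and, for i ≠ 0, ψᵢ = 0 on Lᵢ. For a set
I of indices put c_I = ∑_{i ∈ I} ψᵢuᵢ and g_I = 1 + c_I ⊗ v. Since F is infinite, the uᵢ can be
chosen with total -1 and no proper partial sum -1, so that g_I is invertible except for the full
set, where it is the projection along v onto the kernel of c_I. Each g_I fixes L₀, and on Lᵢ it
ignores whether i ∈ I. Hence the alternating sum over all I of the images of the given element
vanishes, and the degenerate term lies in the group as well. In that term L₀ is unchanged and every
other subspace lies in a hyperplane ker c with c(v) ≠ 0. A transvection along this hyperplane fixes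
those subspaces and moves L₀ to an adjacent point, so subtraction isolates a₀. Transitivity of GL(V)
on adjacent pairs gives the rest (`exists_sum_single_mem_le_ker`, `single_sub_single_mem`).

M₀/M₁ is free on all adjacency components but one. There is a single component exactly when r or r'
is finite: connected points differ by finite-dimensional subspaces only, and in the finite case an
exchange argument joins any two points. -/

/-! ### Rank one perturbations of the identity, and coordinate subspaces. -/

/-- If `1 + c v ≠ 0`, then `x ↦ x + c x • v` is an automorphism. -/
def rankOnePerturbation {F : Type u} {V : Type v} [DivisionRing F] [AddCommGroup V] [Module F V]
    (c : V →ₗ[F] F) (v : V) (h : 1 + c v ≠ 0) : V ≃ₗ[F] V where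
  toFun x := x + c x • v
  map_add' x y := by simp only [map_add, add_smul]; abel
  map_smul' a x := by simp [mul_smul]
  invFun y := y - (c y * (1 + c v)⁻¹) • v
  left_inv x := by
    have : c x + c x * c v = c x * (1 + c v) := by rw [mul_add, mul_one]
    simp [this, mul_assoc, mul_inv_cancel₀ h]
  right_inv y := by
    have : c y - c y * (1 + c v)⁻¹ * c v = c y * (1 + c v)⁻¹ := by
      rw [sub_eq_iff_eq_add, ← mul_one_add, mul_assoc, inv_mul_cancel₀ h, mul_one]
    simp [this]

section

variable {F : Type u} {V : Type v} [DivisionRing F] [AddCommGroup V] [Module F V]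

@[simp]
theorem rankOnePerturbation_apply (c : V →ₗ[F] F) (v : V) (h : 1 + c v ≠ 0) (x : V) :
    rankOnePerturbation c v h x = x + c x • v := rfl

theorem Module.Basis.isCompl_span_image {ι : Type*} (b : Module.Basis ι F V) (s : Set ι) :
    IsCompl (Submodule.span F (b '' s)) (Submodule.span F (b '' sᶜ)) :=
  ⟨b.linearIndependent.disjoint_span_image disjoint_compl_right, by
    rw [codisjoint_iff, ← Submodule.span_union, ← Set.image_union, Set.union_compl_self,
      Set.image_univ, b.span_eq]⟩

theorem Module.Basis.rank_span_image {ι : Type v} (b : Module.Basis ι F V) (s : Set ι) :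
    Module.rank F (Submodule.span F (b '' s)) = Cardinal.mk s := by
  rw [rank_span_set (b.linearIndependent.linearIndepOn_id.mono (Set.image_subset_range _ _))]
  exact Cardinal.mk_image_eq b.injective

theorem Module.Basis.rank_quotient_span_image {ι : Type v} (b : Module.Basis ι F V) (s : Set ι) :
    Module.rank F (V ⧸ Submodule.span F (b '' s)) = Cardinal.mk (sᶜ : Set ι) := by
  rw [(Submodule.quotientEquivOfIsCompl _ _ (b.isCompl_span_image s)).rank_eq, b.rank_span_image]

end

/-! ### Adjacency in the Grassmannian and transitivity on adjacent pairs. -/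

namespace Gr

variable {F : Type u} {V : Type v} [DivisionRing F] [AddCommGroup V] [Module F V]
  {r r' : Cardinal.{v}}

theorem carrier_injective : Function.Injective (carrier : Gr F V r r' → Submodule F V) := by
  rintro ⟨L, _, _⟩ ⟨L', _, _⟩ rfl
  rfl

@[simp]
theorem translate_carrier (g : V ≃ₗ[F] V) (L : Gr F V r r') :
    (translate g L).carrier = L.carrier.map (g : V →ₗ[F] V) := rfl

theorem mem_translate {g : V ≃ₗ[F] V} {L : Gr F V r r'} {x : V} :
    x ∈ (translate g L).carrier ↔ ∃ y ∈ L.carrier, g y = x := Iff.rfl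

theorem translate_congr {g h : V ≃ₗ[F] V} {L : Gr F V r r'} (H : ∀ x ∈ L.carrier, g x = h x) :
    translate g L = translate h L := by
  refine carrier_injective (SetLike.ext fun x => ?_)
  simp only [mem_translate]
  exact exists_congr fun y => and_congr_right fun hy => by rw [H y hy]

theorem translate_eq_self {g : V ≃ₗ[F] V} {L : Gr F V r r'} (H : ∀ x ∈ L.carrier, g x = x) :
    translate g L = L := by
  refine carrier_injective (SetLike.ext fun x => ?_)
  simp only [mem_translate]
  exact ⟨by rintro ⟨y, hy, rfl⟩; rwa [H y hy], fun hx => ⟨x, hx, H x hx⟩⟩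

@[simp]
theorem act_single {A : Type w} [AddCommMonoid A] (g : V ≃ₗ[F] V) (L : Gr F V r r') (a : A) :
    act g (Finsupp.single L a) = Finsupp.single (translate g L) a :=
  Finsupp.mapDomain_single

theorem act_sum {A : Type w} [AddCommMonoid A] {ι : Type*} (g : V ≃ₗ[F] V) (s : Finset ι)
    (x : ι → Gr F V r r' →₀ A) : act g (∑ i ∈ s, x i) = ∑ i ∈ s, act g (x i) :=
  Finsupp.mapDomain_finsetSum

theorem act_sub {A : Type w} [AddCommGroup A] (g : V ≃ₗ[F] V) (x y : Gr F V r r' →₀ A) :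
    act g (x - y) = act g x - act g y :=
  map_sub (Finsupp.mapDomain.addMonoidHom (translate g)) x y

/-- Two points of `Gr` are adjacent if they are distinct and share a common hyperplane. -/
def Adj (L L' : Gr F V r r') : Prop :=
  ∃ (D : Submodule F V) (x y : V), L.carrier = D ⊔ Submodule.span F {x} ∧
    L'.carrier = D ⊔ Submodule.span F {y} ∧ x ∉ L'.carrier ∧ y ∉ L.carrier

theorem Adj.translate {L L' : Gr F V r r'} (g : V ≃ₗ[F] V) :
    Adj L L' → Adj (translate g L) (translate g L') := by
  rintro ⟨D, x, y, h, h', hx, hy⟩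
  refine ⟨D.map (g : V →ₗ[F] V), g x, g y, ?_, ?_, ?_, ?_⟩
  · simp [h, Submodule.map_sup, Submodule.map_span]
  · simp [h', Submodule.map_sup, Submodule.map_span]
  · simpa [mem_translate] using hx
  · simpa [mem_translate] using hy

/-- A transvection `1 + c ⊗ w` moves `L ∌ w` with `c ≠ 0` on `L` to an adjacent point. -/
theorem adj_translate_rankOnePerturbation (L : Gr F V r r') {c : V →ₗ[F] F} {w x : V}
    (hcw : c w = 0) (h : 1 + c w ≠ 0) (hx : x ∈ L.carrier) (hcx : c x = 1) (hw : w ∉ L.carrier) :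
    Adj L (Gr.translate (rankOnePerturbation c w h) L) := by
  refine ⟨L.carrier ⊓ LinearMap.ker c, x, x + w, ?_, ?_, ?_, ?_⟩
  · apply le_antisymm
    · intro z hz
      refine Submodule.mem_sup.2 ⟨z - c z • x, ⟨sub_mem hz (L.carrier.smul_mem _ hx), ?_⟩, c z • x,
        Submodule.smul_mem _ _ (Submodule.mem_span_singleton_self x), by abel⟩
      simp [hcx]
    · exact sup_le inf_le_left ((Submodule.span_singleton_le_iff_mem _ _).2 hx)
  · apply le_antisymm
    · rintro _ ⟨z, hz, rfl⟩
      refine Submodule.mem_sup.2 ⟨z - c z • x, ⟨sub_mem hz (L.carrier.smul_mem _ hx), ?_⟩,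
        c z • (x + w), Submodule.smul_mem _ _ (Submodule.mem_span_singleton_self _), ?_⟩
      · simp [hcx]
      · simp [smul_add, ← add_assoc]
    · refine sup_le ?_ ((Submodule.span_singleton_le_iff_mem _ _).2 ⟨x, hx, by simp [hcx]⟩)
      rintro z ⟨hz, hcz⟩
      exact ⟨z, hz, by simp [LinearMap.mem_ker.1 hcz]⟩
  · rintro ⟨z, hz, hzx⟩
    have hzx' : z + c z • w = x := hzx
    have hcz : c z = 1 := by simpa [hcw, hcx] using congrArg c hzx'
    rw [hcz, one_smul] at hzx'
    exact hw (by simpa [← hzx'] using sub_mem hx hz)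
  · intro hxw
    exact hw (by simpa using sub_mem hxw hx)

/-- A basis of `V` adapted to a pair of adjacent points. -/
theorem Adj.exists_basis {L L' : Gr F V r r'} (h : Adj L L') :
    ∃ (ι κ : Type v) (b : Module.Basis ((ι ⊕ Bool) ⊕ κ) F V),
      Cardinal.mk ι + 1 = r ∧ Cardinal.mk κ + 1 = r' ∧
      L.carrier = Submodule.span F (b '' insert (.inl (.inr false)) (Set.range (.inl ∘ .inl))) ∧
      L'.carrier = Submodule.span F (b '' insert (.inl (.inr true)) (Set.range (.inl ∘ .inl))) := by
  obtain ⟨D, x, y, hL, hL', hx, hy⟩ := h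
  -- A basis of the common hyperplane D, together with x and y, is independent and extends to V. The
  -- index `false` marks x and `true` marks y.
  let bD := Module.Basis.ofVectorSpace F D
  let f : Module.Basis.ofVectorSpaceIndex F D ⊕ Bool → V :=
    Sum.elim (fun i => (bD i : V)) (fun t => cond t y x)
  have hspan : Submodule.span F (Set.range fun i => (bD i : V)) = D := by
    have := congrArg (Submodule.map D.subtype) bD.span_eq
    rwa [Submodule.map_span, Submodule.map_top, Submodule.range_subtype, ← Set.range_comp] at this
  have hf : LinearIndependent F f := by
    refine LinearIndependent.sum_type (bD.linearIndependent.map' D.subtype D.ker_subtype) ?_ ?_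
    · rw [Fintype.linearIndependent_iff]
      intro g hg
      simp only [Fintype.univ_bool, Finset.mem_singleton, Bool.true_eq_false, not_false_eq_true,
        Finset.sum_insert, Finset.sum_singleton, cond_true, cond_false] at hg
      have h1 : g true = 0 := by
        by_contra hne
        refine hy (((L.carrier).smul_mem_iff hne).1 ?_)
        rw [eq_neg_of_add_eq_zero_left hg, hL]
        exact neg_mem (Submodule.mem_sup_right (Submodule.smul_mem _ _
          (Submodule.mem_span_singleton_self x)))
      have h2 : g false = 0 := by
        by_contra hne
        refine hx (((L'.carrier).smul_mem_iff hne).1 ?_)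
        rw [eq_neg_of_add_eq_zero_right hg, hL']
        exact neg_mem (Submodule.mem_sup_right (Submodule.smul_mem _ _
          (Submodule.mem_span_singleton_self y)))
      rintro (_ | _) <;> assumption
    · rw [hspan, Submodule.disjoint_def]
      intro z hz hz'
      have hr : (Set.range fun t => cond t y x) = {y, x} := by
        ext; simp [or_comm, eq_comm]
      rw [hr] at hz'
      obtain ⟨a, b, rfl⟩ := Submodule.mem_span_pair.1 hz'
      have ha : a = 0 := by
        by_contra hne
        refine hy (((L.carrier).smul_mem_iff hne).1 ?_)
        rw [hL]
        simpa using sub_mem (Submodule.mem_sup_left (T := Submodule.span F {x}) hz)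
          (Submodule.mem_sup_right (S := D) (Submodule.smul_mem _ b
            (Submodule.mem_span_singleton_self x)))
      have hb : b = 0 := by
        by_contra hne
        refine hx (((L'.carrier).smul_mem_iff hne).1 ?_)
        rw [hL']
        simpa using sub_mem (Submodule.mem_sup_left (T := Submodule.span F {y}) hz)
          (Submodule.mem_sup_right (S := D) (Submodule.smul_mem _ a
            (Submodule.mem_span_singleton_self y)))
      simp [ha, hb]
  let b := Module.Basis.sumExtend hf
  have hb : ∀ i, b (.inl i) = f i := fun i => by
    simp only [b, Module.Basis.sumExtend, Module.Basis.reindex_apply, Module.Basis.extend_apply_self]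
    rfl
  have key : ∀ t, Submodule.span F
      (b '' insert (.inl (.inr t)) (Set.range (.inl ∘ .inl))) =
        D ⊔ Submodule.span F {cond t y x} := fun t => by
    rw [Set.image_insert_eq, ← Set.range_comp, Submodule.span_insert, sup_comm, hb]
    congr 2
    refine Eq.trans ?_ hspan
    congr 2
    ext i
    simp [hb, f]
  refine ⟨_, _, b, ?_, ?_, by rw [key, hL]; rfl, by rw [key, hL']; rfl⟩
  · rw [← L.rank_eq, hL, show x = cond false y x from rfl, ← key, b.rank_span_image,
      Cardinal.mk_insert (by simp), Cardinal.mk_range_eq _ (Sum.inl_injective.comp Sum.inl_injective)]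
  · rw [← L.corank_eq, hL, show x = cond false y x from rfl, ← key, b.rank_quotient_span_image]
    -- The complement of L is spanned by y and the vectors indexed by κ, hence r' = |κ| + 1.
    rw [show (insert (.inl (.inr false)) (Set.range (.inl ∘ .inl)) : Set
      ((Module.Basis.ofVectorSpaceIndex F D ⊕ Bool) ⊕ _))ᶜ =
        insert (.inl (.inr true)) (Set.range .inr) by
      ext ((i | (_ | _)) | k) <;> simp]
    rw [Cardinal.mk_insert (by simp), Cardinal.mk_range_eq _ Sum.inr_injective]

/-- `GL(V)` acts transitively on ordered pairs of adjacent points. -/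
theorem Adj.exists_translate {L₁ L₁' L₂ L₂' : Gr F V r r'} (h₁ : Adj L₁ L₁') (h₂ : Adj L₂ L₂') :
    ∃ g : V ≃ₗ[F] V, Gr.translate g L₁ = L₂ ∧ Gr.translate g L₁' = L₂' := by
  obtain ⟨ι₁, κ₁, b₁, hι₁, hκ₁, e₁, e₁'⟩ := h₁.exists_basis
  obtain ⟨ι₂, κ₂, b₂, hι₂, hκ₂, e₂, e₂'⟩ := h₂.exists_basis
  -- Adding 1 is cancellable even for infinite cardinals, so the index types match.
  obtain ⟨eι⟩ := Cardinal.eq.1 (Cardinal.add_one_inj.1 (hι₁.trans hι₂.symm))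
  obtain ⟨eκ⟩ := Cardinal.eq.1 (Cardinal.add_one_inj.1 (hκ₁.trans hκ₂.symm))
  let g := b₁.equiv b₂ ((eι.sumCongr (Equiv.refl Bool)).sumCongr eκ)
  have key : ∀ t, (Submodule.span F
      (b₁ '' insert (.inl (.inr t)) (Set.range (.inl ∘ .inl)))).map (g : V →ₗ[F] V) =
      Submodule.span F (b₂ '' insert (.inl (.inr t)) (Set.range (.inl ∘ .inl))) := fun t => by
    rw [Submodule.map_span, ← Set.image_comp]
    congr 1
    simp only [Set.image_insert_eq, ← Set.range_comp]
    congr 1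
    · simp [g]
    · rw [← eι.surjective.range_comp]
      congr 1
      ext i
      simp [g]
  exact ⟨g, carrier_injective (by rw [translate_carrier, e₁, e₂, key]),
    carrier_injective (by rw [translate_carrier, e₁', e₂', key])⟩

/-- A basis of `V` and a set of basis vectors of the right size define a point of `Gr`. -/
def ofBasis {ι : Type v} (b : Module.Basis ι F V) (s : Set ι) (hs : Cardinal.mk s = r)
    (hs' : Cardinal.mk (sᶜ : Set ι) = r') : Gr F V r r' :=
  ⟨Submodule.span F (b '' s), (b.rank_span_image s).trans hs,
    (b.rank_quotient_span_image s).trans hs'⟩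

theorem exists_basis (hV : Module.rank F V = r + r') :
    Nonempty (Module.Basis (r.out ⊕ r'.out) F V) := by
  let b := Module.Basis.ofVectorSpace F V
  have : Cardinal.mk (Module.Basis.ofVectorSpaceIndex F V) = Cardinal.mk (r.out ⊕ r'.out) := by
    rw [b.mk_eq_rank'', hV]; simp
  exact ⟨b.reindex (Cardinal.eq.1 this).some⟩

theorem nonempty (hV : Module.rank F V = r + r') : Nonempty (Gr F V r r') := by
  obtain ⟨b⟩ := exists_basis hV
  refine ⟨ofBasis b (Set.range .inl) ?_ ?_⟩
  · rw [Cardinal.mk_range_eq _ Sum.inl_injective, Cardinal.mk_out]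
  · rw [Set.compl_range_inl, Cardinal.mk_range_eq _ Sum.inr_injective, Cardinal.mk_out]

theorem carrier_ne_bot (hr : 1 ≤ r) (L : Gr F V r r') : L.carrier ≠ ⊥ := by
  intro h
  have := L.rank_eq
  rw [h, rank_bot] at this
  simp [← this] at hr

theorem carrier_ne_top (hr' : 1 ≤ r') (L : Gr F V r r') : L.carrier ≠ ⊤ := by
  intro h
  have : Subsingleton (V ⧸ L.carrier) := Submodule.Quotient.subsingleton_iff.2 h
  have hr0 := L.corank_eq
  rw [rank_subsingleton'] at hr0
  simp [← hr0] at hr'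

theorem exists_adj (hr : 1 ≤ r) (hr' : 1 ≤ r') (hV : Module.rank F V = r + r') :
    ∃ L L' : Gr F V r r', Adj L L' := by
  obtain ⟨L⟩ := nonempty hV
  obtain ⟨x, hx, hx0⟩ := L.carrier.ne_bot_iff.1 (L.carrier_ne_bot hr)
  obtain ⟨w, hw⟩ : ∃ w, w ∉ L.carrier := by
    by_contra! h
    exact L.carrier_ne_top hr' (eq_top_iff.2 fun z _ => h z)
  have hxw : x ∉ Submodule.span F {w} := fun h => by
    obtain ⟨a, rfl⟩ := Submodule.mem_span_singleton.1 h
    exact hw ((L.carrier.smul_mem_iff fun ha => hx0 (by simp [ha])).1 hx)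
  obtain ⟨c, hc, hcw⟩ := Submodule.exists_le_ker_of_notMem hxw
  have hw0 : c w = 0 := hcw (Submodule.mem_span_singleton_self w)
  refine ⟨L, _, adj_translate_rankOnePerturbation L (c := c) (w := w) (x := (c x)⁻¹ • x) hw0
    (by simp [hw0]) (L.carrier.smul_mem _ hx) (by simp [hc]) hw⟩

end Gr

/-! ### Scalars with prescribed partial sums, and alternating sums over subsets. -/

/-- Scalars are chosen one at a time; each new one has only finitely many values to avoid, the
negatives of the earlier subset sums. -/
theorem exists_forall_sum_ne_zero {F ι : Type*} [DivisionRing F] [Infinite F] (s : Finset ι) :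
    ∃ w : ι → F, ∀ I ⊆ s, I.Nonempty → ∑ i ∈ I, w i ≠ 0 := by
  classical
  induction s using Finset.induction_on with
  | empty => exact ⟨0, fun I hI hI' => absurd (Finset.subset_empty.1 hI) hI'.ne_empty⟩
  | insert a s ha ih =>
    obtain ⟨w, hw⟩ := ih
    obtain ⟨t, ht⟩ := Infinite.exists_notMem_finset (s.powerset.image fun I => -∑ i ∈ I, w i)
    refine ⟨Function.update w a t, fun I hI hI' => ?_⟩
    by_cases haI : a ∈ I
    · rw [← Finset.add_sum_erase _ _ haI, Function.update_self,
        Finset.sum_update_of_notMem (Finset.notMem_erase a I)]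
      intro h
      exact ht (Finset.mem_image.2 ⟨I.erase a,
        Finset.mem_powerset.2 (Finset.subset_insert_iff.1 hI), (eq_neg_of_add_eq_zero_left h).symm⟩)
    · rw [Finset.sum_update_of_notMem haI]
      exact hw I ((Finset.subset_insert_iff_of_notMem haI).1 hI) hI'

/-- Normalise scalars with nonzero subset sums by minus their total: a proper subset with sum -1
would leave a nonempty complement with sum 0. -/
theorem exists_sum_eq_neg_one (F : Type*) {ι : Type*} [DivisionRing F] [Infinite F] [Fintype ι]
    [Nonempty ι] :
    ∃ u : ι → F, ∑ i, u i = -1 ∧ ∀ I ≠ Finset.univ, 1 + ∑ i ∈ I, u i ≠ 0 := by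
  classical
  obtain ⟨w, hw⟩ := exists_forall_sum_ne_zero (F := F) (Finset.univ : Finset ι)
  have hs := hw _ subset_rfl Finset.univ_nonempty
  refine ⟨fun i => -(w i * (∑ i, w i)⁻¹), ?_, fun I hI h => ?_⟩
  · rw [Finset.sum_neg_distrib, ← Finset.sum_mul, mul_inv_cancel₀ hs]
  · rw [Finset.sum_neg_distrib, ← Finset.sum_mul, ← sub_eq_add_neg, sub_eq_zero,
      eq_mul_inv_iff_mul_eq₀ hs, one_mul, ← Finset.sum_add_sum_compl I, add_eq_left] at h
    refine hw Iᶜ (Finset.subset_univ _) ?_ h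
    rwa [Finset.nonempty_iff_ne_empty, Ne, Finset.compl_eq_empty_iff]

/-- The alternating sum over all subsets vanishes if the summand ignores membership of `i`. -/
theorem Finset.sum_neg_one_pow_card_smul_eq_zero {ι M : Type*} [Fintype ι] [DecidableEq ι]
    [AddCommGroup M] (f : Finset ι → M) (i : ι) (hf : ∀ I, i ∉ I → f (insert i I) = f I) :
    ∑ I, (-1 : ℤ) ^ I.card • f I = 0 := by
  rw [← Finset.powerset_univ, ← Finset.insert_erase (Finset.mem_univ i),
    Finset.sum_powerset_insert (Finset.notMem_erase _ _), ← Finset.sum_add_distrib]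
  refine Finset.sum_eq_zero fun I hI => ?_
  have hi : i ∉ I := fun h => Finset.notMem_erase i _ (Finset.mem_powerset.1 hI h)
  rw [hf I hi, Finset.card_insert_of_notMem hi, pow_succ]
  simp

/-! ### Isolating one coefficient in a stable subgroup. -/

namespace Gr

variable {F : Type u} {V : Type v} [DivisionRing F] [AddCommGroup V] [Module F V]
  {r r' : Cardinal.{v}} {A : Type w}

/-- Alternating sum of rank one perturbations pushing all but one subspace into a hyperplane. -/
theorem exists_sum_single_mem_le_ker [Infinite F] [AddCommGroup A] {ι : Type*} [Fintype ι]
    (S : AddSubgroup (Gr F V r r' →₀ A)) (hS : ∀ (g : V ≃ₗ[F] V), ∀ x ∈ S, act g x ∈ S)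
    (a : ι → A) (L : ι → Gr F V r r') (hL : ∑ i, Finsupp.single (L i) (a i) ∈ S)
    (i₀ : ι) {v : V} (hv0 : v ≠ 0) (hv₀ : v ∈ (L i₀).carrier) (hv : ∀ i ≠ i₀, v ∉ (L i).carrier) :
    ∃ (L' : ι → Gr F V r r') (c : V →ₗ[F] F), L' i₀ = L i₀ ∧ c v = 1 ∧
      (∀ i ≠ i₀, (L' i).carrier ≤ LinearMap.ker c) ∧ ∑ i, Finsupp.single (L' i) (a i) ∈ S := by
  classical
  have hψ : ∀ i, ∃ ψ : V →ₗ[F] F, ψ v = 1 ∧ (i ≠ i₀ → (L i).carrier ≤ LinearMap.ker ψ) := by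
    intro i
    obtain ⟨p, hp, hvp⟩ : ∃ p : Submodule F V, (i ≠ i₀ → p = (L i).carrier) ∧ v ∉ p := by
      by_cases hi : i = i₀
      -- For i₀ only ψ(v) = 1 is needed, so the zero subspace stands in for L i₀.
      · exact ⟨⊥, fun h => absurd hi h, by simpa using hv0⟩
      · exact ⟨_, fun _ => rfl, hv i hi⟩
    obtain ⟨f, hf, hpf⟩ := Submodule.exists_le_ker_of_notMem hvp
    refine ⟨LinearMap.toSpanSingleton F F (f v)⁻¹ ∘ₗ f, by simp [hf], fun hi x hx => ?_⟩
    have : f x = 0 := hpf (hp hi ▸ hx)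
    simp [this]
  choose ψ hψv hψL using hψ
  have : Nonempty ι := ⟨i₀⟩
  obtain ⟨u, hu, hu'⟩ := exists_sum_eq_neg_one F (ι := ι)
  let c : Finset ι → V →ₗ[F] F := fun I => ∑ i ∈ I, LinearMap.toSpanSingleton F F (u i) ∘ₗ ψ i
  have hcv : ∀ I, c I v = ∑ i ∈ I, u i := fun I => by simp [c, hψv]
  have hc : ∀ I ≠ Finset.univ, 1 + c I v ≠ 0 := fun I hI => by rw [hcv]; exact hu' I hI
  have hce : ∀ i ≠ i₀, ∀ I, ∀ x ∈ (L i).carrier, c (I.erase i) x = c I x := by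
    intro i hi I x hx
    have hx0 : ψ i x = 0 := hψL i hi hx
    simp only [c, LinearMap.sum_apply]
    exact Finset.sum_erase _ (by simp [hx0])
  -- The identity at the full set is a dummy value: there 1 + c_I ⊗ v is not invertible.
  let g : Finset ι → V ≃ₗ[F] V := fun I =>
    if h : I = Finset.univ then LinearEquiv.refl F V else rankOnePerturbation (c I) v (hc I h)
  have hg : ∀ I ≠ Finset.univ, ∀ x, g I x = x + c I x • v := fun I hI x => by simp [g, hI]
  have herase : ∀ (I : Finset ι) i, I.erase i ≠ Finset.univ := fun I i h =>
    Finset.notMem_erase i I (h ▸ Finset.mem_univ i)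
  -- The image of L i under 1 + c_I ⊗ v, written so that it makes sense for the full set too: on L i
  -- with i ≠ i₀, removing i from I changes nothing and restores invertibility.
  let K : ι → Finset ι → Gr F V r r' := fun i I =>
    if i = i₀ then L i else translate (g (I.erase i)) (L i)
  have hK : ∀ i, ∀ I ≠ Finset.univ, translate (g I) (L i) = K i I := by
    intro i I hI
    by_cases hi : i = i₀
    · subst hi
      simp only [K, if_true]
      refine carrier_injective (le_antisymm ?_ fun x hx => ?_)
      · rintro _ ⟨x, hx, rfl⟩
        exact (hg I hI x).symm ▸ add_mem hx (Submodule.smul_mem _ _ hv₀)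
      · have h1 : g I v = (1 + c I v) • v := by rw [hg I hI, add_smul, one_smul]
        refine ⟨x - (c I x * (1 + c I v)⁻¹) • v, sub_mem hx (Submodule.smul_mem _ _ hv₀), ?_⟩
        change g I _ = x
        rw [map_sub, map_smul, h1, hg I hI, smul_smul, mul_assoc, inv_mul_cancel₀ (hc I hI)]
        simp
    · simp only [K, if_neg hi]
      exact translate_congr fun x hx => by rw [hg I hI, hg _ (herase I i), hce i hi I x hx]
  have hK0 : ∀ i, ∑ I, (-1 : ℤ) ^ I.card • Finsupp.single (K i I) (a i) = 0 := by
    intro i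
    refine Finset.sum_neg_one_pow_card_smul_eq_zero _ i fun I hI => ?_
    simp only [K, Finset.erase_insert_eq_erase]
  have hsum : ∑ I, (-1 : ℤ) ^ I.card • ∑ i, Finsupp.single (K i I) (a i) = 0 := by
    simp_rw [Finset.smul_sum]
    rw [Finset.sum_comm]
    exact Finset.sum_eq_zero fun i _ => hK0 i
  -- Every term except the full set is a translate of the given element, so the full-set term lies
  -- in S up to sign.
  rw [← Finset.add_sum_erase _ _ (Finset.mem_univ Finset.univ)] at hsum
  have hmem : (-1 : ℤ) ^ (Finset.univ : Finset ι).card •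
      ∑ i, Finsupp.single (K i Finset.univ) (a i) ∈ S := by
    rw [eq_neg_of_add_eq_zero_left hsum]
    refine neg_mem (sum_mem fun I hI => S.zsmul_mem ?_ _)
    have := hS (g I) _ hL
    rw [act_sum] at this
    simpa only [act_single, hK _ I (Finset.ne_of_mem_erase hI)] using this
  -- For the full set c(v) = -1, so c(x + c(x)v) = c(x)(1 + c(v)) = 0; the sign makes the value at v
  -- equal to 1.
  refine ⟨fun i => K i Finset.univ, -c Finset.univ, by simp [K], by simp [hcv, hu], ?_, ?_⟩
  · intro i hi
    simp only [K, if_neg hi]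
    rintro _ ⟨x, hx, rfl⟩
    have hgx : g (Finset.univ.erase i) x = x + c Finset.univ x • v := by
      rw [hg _ (herase _ i), hce i hi _ x hx]
    change -c Finset.univ (g (Finset.univ.erase i) x) = 0
    rw [hgx]
    simp [hcv, hu]
  · have := S.zsmul_mem hmem ((-1 : ℤ) ^ (Finset.univ : Finset ι).card)
    rwa [smul_smul, ← mul_pow, neg_one_mul, neg_neg, one_pow, one_smul] at this

/-- A stable subgroup containing `∑ aᵢ [Lᵢ]` contains `a₀ ([L] - [L'])` for adjacent `L`, `L'`. -/
theorem single_sub_single_mem [Infinite F] [AddCommGroup A] {ι : Type*} [Fintype ι]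
    (hr' : 1 ≤ r')
    (S : AddSubgroup (Gr F V r r' →₀ A)) (hS : ∀ (g : V ≃ₗ[F] V), ∀ x ∈ S, act g x ∈ S)
    (a : ι → A) (L : ι → Gr F V r r') (hL : ∑ i, Finsupp.single (L i) (a i) ∈ S)
    (i₀ : ι) {v : V} (hv0 : v ≠ 0) (hv₀ : v ∈ (L i₀).carrier) (hv : ∀ i ≠ i₀, v ∉ (L i).carrier)
    {K K' : Gr F V r r'} (hK : Adj K K') :
    Finsupp.single K (a i₀) - Finsupp.single K' (a i₀) ∈ S := by
  classical
  obtain ⟨L', c, h₀, hcv, hLc, hmem⟩ := exists_sum_single_mem_le_ker S hS a L hL i₀ hv0 hv₀ hv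
  -- If ker c were contained in L i₀, which also contains v, then L i₀ would be all of V.
  obtain ⟨w, hcw, hw⟩ : ∃ w, c w = 0 ∧ w ∉ (L i₀).carrier := by
    by_contra! h
    refine carrier_ne_top hr' (L i₀) (eq_top_iff.2 fun x _ => ?_)
    have := add_mem (h (x - c x • v) (by simp [hcv])) ((L i₀).carrier.smul_mem (c x) hv₀)
    simpa using this
  have hne : 1 + c w ≠ 0 := by simp [hcw]
  have hadj := adj_translate_rankOnePerturbation (L i₀) hcw hne hv₀ hcv hw
  obtain ⟨g, hg, hg'⟩ := hadj.exists_translate hK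
  have hfix : ∀ i ≠ i₀, translate (rankOnePerturbation c w hne) (L' i) = L' i := fun i hi =>
    translate_eq_self fun x hx => by simp [LinearMap.mem_ker.1 (hLc i hi hx)]
  have hdiff := hS g _ (sub_mem hmem (hS (rankOnePerturbation c w hne) _ hmem))
  rw [act_sum, ← Finset.sum_sub_distrib, Finset.sum_eq_single i₀ ?_ (by simp)] at hdiff
  · rwa [act_sub, act_single, act_single, act_single, h₀, hg, hg'] at hdiff
  · intro i _ hi
    rw [act_single, hfix i hi, sub_self]

end Gr

/-! ### Connected components of the adjacency relation. -/

namespace Gr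

variable {F : Type u} {V : Type v} [DivisionRing F] [AddCommGroup V] [Module F V]
  {r r' : Cardinal.{v}} {A : Type w}

theorem eq_of_le_of_finite (h : r < Cardinal.aleph0 ∨ r' < Cardinal.aleph0) {L L' : Gr F V r r'}
    (hle : L.carrier ≤ L'.carrier) : L = L' := by
  refine carrier_injective (hle.antisymm ?_)
  rcases h with h | h
  · have : Module.Finite F L'.carrier := Module.rank_lt_aleph0_iff.1 (by rwa [L'.rank_eq])
    refine (Submodule.eq_of_le_of_finrank_eq hle ?_).ge
    simp only [Module.finrank, L.rank_eq, L'.rank_eq]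
  · have : Module.Finite F (V ⧸ L.carrier) := Module.rank_lt_aleph0_iff.1 (by rwa [L.corank_eq])
    have : Module.Finite F (V ⧸ L'.carrier) := Module.rank_lt_aleph0_iff.1 (by rwa [L'.corank_eq])
    have hinj : Function.Injective (Submodule.factor hle) :=
      (LinearMap.injective_iff_surjective_of_finrank_eq_finrank (by
        simp only [Module.finrank, L.corank_eq, L'.corank_eq])).2 (Submodule.factor_surjective hle)
    intro x hx
    rw [← Submodule.Quotient.mk_eq_zero]
    apply hinj
    rw [map_zero]
    exact (Submodule.Quotient.mk_eq_zero _).2 hx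

/-- One step of a chain of adjacent points from `L` towards `L'`. -/
theorem exists_adj_inf_lt (h : r < Cardinal.aleph0 ∨ r' < Cardinal.aleph0) {L L' : Gr F V r r'}
    (hne : L ≠ L') : ∃ L'' : Gr F V r r', Adj L L'' ∧
      L.carrier ⊓ L'.carrier < L''.carrier ⊓ L'.carrier := by
  obtain ⟨x, hx, hx'⟩ := SetLike.not_le_iff_exists.1 fun hle => hne (eq_of_le_of_finite h hle)
  obtain ⟨y, hy, hy'⟩ := SetLike.not_le_iff_exists.1 fun hle =>
    hne (eq_of_le_of_finite h hle).symm
  obtain ⟨φ, hφx, hφ⟩ := Submodule.exists_le_ker_of_notMem hx'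
  obtain ⟨χ, hχy, hχ⟩ := Submodule.exists_le_ker_of_notMem hy'
  -- This c vanishes on L ∩ L' and takes the value 1 at x and y, so the transvection 1 + c ⊗ (y - x)
  -- fixes L ∩ L' and carries x to y.
  let c : V →ₗ[F] F := LinearMap.toSpanSingleton F F (φ x)⁻¹ ∘ₗ φ +
    LinearMap.toSpanSingleton F F (χ y)⁻¹ ∘ₗ χ
  have hcx : c x = 1 := by simp [c, hφx, LinearMap.mem_ker.1 (hχ hx)]
  have hcy : c y = 1 := by simp [c, hχy, LinearMap.mem_ker.1 (hφ hy)]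
  have hcw : c (y - x) = 0 := by rw [map_sub, hcx, hcy, sub_self]
  have hone : 1 + c (y - x) ≠ 0 := by simp [hcw]
  have hw : y - x ∉ L.carrier := fun hmem => hy' (by simpa using add_mem hmem hx)
  refine ⟨_, adj_translate_rankOnePerturbation L hcw hone hx hcx hw,
    lt_of_le_of_ne (fun z hz => ⟨⟨z, hz.1, ?_⟩, hz.2⟩) fun heq => hy' ?_⟩
  · have hcz : c z = 0 := by simp [c, LinearMap.mem_ker.1 (hφ hz.2), LinearMap.mem_ker.1 (hχ hz.1)]
    change z + c z • (y - x) = z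
    rw [hcz, zero_smul, add_zero]
  · refine (heq.ge ⟨⟨x, hx, ?_⟩, hy⟩ : y ∈ L.carrier ⊓ L'.carrier).1
    change x + c x • (y - x) = y
    rw [hcx, one_smul, add_sub_cancel]

/-- Induction on dim L'/(L ∩ L'), which is finite in either case and drops with each exchange step.
-/
theorem eqvGen_adj_of_finite (h : r < Cardinal.aleph0 ∨ r' < Cardinal.aleph0)
    (L L' : Gr F V r r') : Relation.EqvGen Adj L L' := by
  have hfin : ∀ L : Gr F V r r',
      Module.Finite F (L'.carrier ⧸ L.carrier.comap L'.carrier.subtype) := by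
    intro L
    rcases h with h | h
    · have : Module.Finite F L'.carrier := Module.rank_lt_aleph0_iff.1 (by rwa [L'.rank_eq])
      infer_instance
    · have : Module.Finite F (V ⧸ L.carrier) := Module.rank_lt_aleph0_iff.1 (by rwa [L.corank_eq])
      refine Module.Finite.of_injective (Submodule.mapQ _ L.carrier L'.carrier.subtype le_rfl) ?_
      rw [← LinearMap.ker_eq_bot, Submodule.ker_mapQ, ← le_bot_iff, Submodule.map_le_iff_le_comap,
        Submodule.comap_bot, Submodule.ker_mkQ]
  induction hk : Module.finrank F (L'.carrier ⧸ L.carrier.comap L'.carrier.subtype)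
    using Nat.strong_induction_on generalizing L with
  | _ k ih =>
    by_cases hne : L = L'
    · exact hne ▸ Relation.EqvGen.refl _
    obtain ⟨L'', hadj, hlt⟩ := exists_adj_inf_lt h hne
    refine (Relation.EqvGen.rel _ _ hadj).trans _ _ _ (ih _ ?_ L'' rfl)
    subst hk
    have hle : L.carrier.comap L'.carrier.subtype ≤ L''.carrier.comap L'.carrier.subtype :=
      fun z hz => (hlt.le ⟨hz, z.2⟩).1
    obtain ⟨y, hy, hy'⟩ := SetLike.exists_of_lt hlt
    have := hfin L
    rw [← (Submodule.quotientQuotientEquivQuotient _ _ hle).finrank_eq]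
    rw [← Submodule.finrank_quotient_add_finrank
      ((L''.carrier.comap L'.carrier.subtype).map (L.carrier.comap L'.carrier.subtype).mkQ)]
    refine Nat.lt_add_of_pos_right (Submodule.one_le_finrank_iff.2 ?_)
    rw [Submodule.ne_bot_iff]
    refine ⟨Submodule.Quotient.mk ⟨y, hy.2⟩, Submodule.mem_map_of_mem (f := Submodule.mkQ _) hy.1,
      fun h0 => hy' ⟨?_, hy.2⟩⟩
    have hmem := (Submodule.Quotient.mk_eq_zero _).1 h0
    exact hmem

/-- The invariant that separates components: agreement up to a finite-dimensional subspace. -/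
theorem exists_finite_le_sup_of_eqvGen_adj {L L' : Gr F V r r'} (h : Relation.EqvGen Adj L L') :
    ∃ W : Submodule F V, Module.Finite F W ∧ L.carrier ≤ L'.carrier ⊔ W ∧
      L'.carrier ≤ L.carrier ⊔ W := by
  induction h with
  | rel L L' h =>
    obtain ⟨D, x, y, hL, hL', -, -⟩ := h
    refine ⟨Submodule.span F {x} ⊔ Submodule.span F {y}, inferInstance, ?_, ?_⟩
    · rw [hL, hL']
      exact sup_le (le_sup_of_le_left le_sup_left) (le_sup_of_le_right le_sup_left)
    · rw [hL, hL']
      exact sup_le (le_sup_of_le_left le_sup_left) (le_sup_of_le_right le_sup_right)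
  | refl L => exact ⟨⊥, inferInstance, le_sup_left, le_sup_left⟩
  | symm L L' _ ih =>
    obtain ⟨W, hW, h, h'⟩ := ih
    exact ⟨W, hW, h', h⟩
  | trans L₁ L₂ L₃ _ _ ih ih' =>
    obtain ⟨W, hW, h₁, h₂⟩ := ih
    obtain ⟨W', hW', h₂', h₃⟩ := ih'
    refine ⟨W ⊔ W', inferInstance, h₁.trans (sup_le (h₂'.trans ?_) ?_),
      h₃.trans (sup_le (h₂.trans ?_) ?_)⟩
    · exact sup_le_sup_left le_sup_right _
    · exact le_sup_of_le_right le_sup_left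
    · exact sup_le_sup_left le_sup_left _
    · exact le_sup_of_le_right le_sup_right

/-- Exchanging a countably infinite set of basis vectors of L with one outside L changes L by more
than any finite-dimensional subspace. -/
theorem exists_not_eqvGen_adj (h : Cardinal.aleph0 ≤ r) (h' : Cardinal.aleph0 ≤ r')
    (hV : Module.rank F V = r + r') : ∃ L L' : Gr F V r r', ¬ Relation.EqvGen Adj L L' := by
  obtain ⟨b₀⟩ := exists_basis hV
  have hcard : ∀ s : Cardinal.{v}, Cardinal.aleph0 ≤ s →
      Cardinal.mk (ULift.{v} ℕ ⊕ s.out) = s := fun s hs => by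
    simp [Cardinal.add_eq_right hs hs]
  obtain ⟨e⟩ := Cardinal.eq.1 ((hcard r h).trans r.mk_out.symm)
  obtain ⟨e'⟩ := Cardinal.eq.1 ((hcard r' h').trans r'.mk_out.symm)
  let b := b₀.reindex (e.sumCongr e').symm
  let s : Set ((ULift.{v} ℕ ⊕ r.out) ⊕ (ULift.{v} ℕ ⊕ r'.out)) := Set.range .inl
  -- Swaps the two copies of ℕ and fixes the other indices.
  let σ : (ULift.{v} ℕ ⊕ r.out) ⊕ (ULift.{v} ℕ ⊕ r'.out) ≃
      (ULift.{v} ℕ ⊕ r.out) ⊕ (ULift.{v} ℕ ⊕ r'.out) := Equiv.sumSumSumComm _ _ _ _ |>.trans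
        ((Equiv.sumComm _ _).sumCongr (Equiv.refl _)) |>.trans (Equiv.sumSumSumComm _ _ _ _)
  let L : Gr F V r r' := ofBasis b s
    ((Cardinal.mk_range_eq _ Sum.inl_injective).trans (hcard r h))
    (by rw [Set.compl_range_inl, Cardinal.mk_range_eq _ Sum.inr_injective, hcard r' h'])
  refine ⟨L, translate (b.equiv b σ) L, fun hE => ?_⟩
  obtain ⟨W, hW, hle, -⟩ := exists_finite_le_sup_of_eqvGen_adj hE
  let L' := (translate (b.equiv b σ) L).carrier
  have hL' : L' = Submodule.span F (b '' (σ '' s)) := by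
    simp only [L', translate_carrier, L, ofBasis, Submodule.map_span]
    rw [← Set.image_comp, ← Set.image_comp]
    congr 1
    exact Set.image_congr fun i _ => by simp
  -- P is infinite-dimensional, lies in L and meets L' trivially; it would embed into the image of W
  -- in V/L'.
  let P : Submodule F V := Submodule.span F (b '' Set.range (.inl ∘ .inl))
  have hP : P ≤ L.carrier := Submodule.span_mono (Set.image_mono (by rintro _ ⟨n, rfl⟩; simp [s]))
  have hdisj : Disjoint P L' := by
    rw [hL']
    refine b.linearIndependent.disjoint_span_image ?_
    rw [Set.disjoint_left]
    rintro _ ⟨n, rfl⟩ ⟨_, ⟨(m | m), rfl⟩, hm⟩ <;> simp [σ] at hm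
  have hfin : Module.Finite F (W.map L'.mkQ) := inferInstance
  have hmap : ∀ x : P, L'.mkQ x ∈ W.map L'.mkQ := fun x => by
    obtain ⟨y, hy, z, hz, hyz⟩ := Submodule.mem_sup.1 (hle (hP x.2))
    refine ⟨z, hz, ?_⟩
    rw [← hyz, map_add, (Submodule.mkQ_apply L' y).trans ((Submodule.Quotient.mk_eq_zero _).2 hy),
      zero_add]
  have hPfin : Module.Finite F P := by
    refine Module.Finite.of_injective
      ((L'.mkQ ∘ₗ P.subtype).codRestrict (W.map L'.mkQ) hmap) ?_
    rw [← LinearMap.ker_eq_bot, LinearMap.ker_eq_bot']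
    intro x hx
    have hx' : (x : V) ∈ L' := (Submodule.Quotient.mk_eq_zero _).1 (congrArg Subtype.val hx)
    exact Subtype.ext (Submodule.disjoint_def.1 hdisj _ x.2 hx')
  have hrank := b.rank_span_image (Set.range (.inl ∘ .inl))
  rw [Cardinal.mk_range_eq _ (Sum.inl_injective.comp Sum.inl_injective)] at hrank
  have := Module.rank_lt_aleph0_iff.2 hPfin
  rw [show Module.rank F P = _ from hrank] at this
  simp at this

/-! ### The submodule M₁ and the quotient M₀/M₁. -/

/-- The subgroup of `ℤ[Gr]` spanned by the differences of adjacent points. -/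
noncomputable def adjSpan (F : Type u) (V : Type v) [DivisionRing F] [AddCommGroup V] [Module F V]
    (r r' : Cardinal.{v}) : Submodule ℤ (Gr F V r r' →₀ ℤ) :=
  Submodule.span ℤ {x | ∃ L L', Adj L L' ∧ x = Finsupp.single L 1 - Finsupp.single L' 1}

theorem mem_degreeZero {R : Type*} [Semiring R] [AddCommMonoid A] [Module R A]
    {x : Gr F V r r' →₀ A} : x ∈ degreeZero F V r r' R A ↔ (x.sum fun _ a => a) = 0 := Iff.rfl

theorem single_sub_single_mem_degreeZero (L L' : Gr F V r r') :
    Finsupp.single L (1 : ℤ) - Finsupp.single L' 1 ∈ degreeZero F V r r' ℤ ℤ := by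
  rw [degreeZero, LinearMap.mem_ker, map_sub]
  simp

theorem adjSpan_le_degreeZero : adjSpan F V r r' ≤ degreeZero F V r r' ℤ ℤ := by
  rw [adjSpan, Submodule.span_le]
  rintro _ ⟨L, L', -, rfl⟩
  exact single_sub_single_mem_degreeZero L L'

theorem isGStable_adjSpan : IsGStable (adjSpan F V r r') := by
  intro g x hx
  induction hx using Submodule.span_induction with
  | mem x hx =>
    obtain ⟨L, L', h, rfl⟩ := hx
    rw [act_sub, act_single, act_single]
    exact Submodule.subset_span ⟨_, _, h.translate g, rfl⟩
  | zero => simp [act]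
  | add x y _ _ hx hy => rw [act, Finsupp.mapDomain_add]; exact add_mem hx hy
  | smul a x _ hx => rw [act, Finsupp.mapDomain_smul]; exact Submodule.smul_mem _ _ hx

theorem isGStable_degreeZero : IsGStable (degreeZero F V r r' ℤ ℤ) := by
  intro g x hx
  rw [mem_degreeZero] at hx ⊢
  rwa [act, Finsupp.sum_mapDomain_index (fun _ => rfl) (fun _ _ _ => rfl)]

theorem adjSpan_ne_bot (hr : 1 ≤ r) (hr' : 1 ≤ r') (hV : Module.rank F V = r + r') :
    adjSpan F V r r' ≠ ⊥ := by
  obtain ⟨L, L', h⟩ := exists_adj hr hr' hV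
  have hne : L ≠ L' := by
    rintro rfl
    obtain ⟨D, x, y, hL, -, hx, -⟩ := h
    exact hx (hL ▸ Submodule.mem_sup_right (Submodule.mem_span_singleton_self x))
  rw [Submodule.ne_bot_iff]
  refine ⟨_, Submodule.subset_span ⟨L, L', h, rfl⟩, fun h0 => ?_⟩
  exact hne (Finsupp.single_left_injective one_ne_zero (sub_eq_zero.1 h0))

theorem single_sub_single_mem_adjSpan {L L' : Gr F V r r'} (h : Relation.EqvGen Adj L L') :
    Finsupp.single L (1 : ℤ) - Finsupp.single L' 1 ∈ adjSpan F V r r' := by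
  induction h with
  | rel L L' h => exact Submodule.subset_span ⟨L, L', h, rfl⟩
  | refl L => simp
  | symm L L' _ ih => simpa using neg_mem ih
  | trans L₁ L₂ L₃ _ _ ih ih' => simpa using add_mem ih ih'

/-- `ℤ[Gr] → ℤ[Gr / Adj]`, with kernel `adjSpan`. -/
noncomputable def toComponents (F : Type u) (V : Type v) [DivisionRing F] [AddCommGroup V]
    [Module F V] (r r' : Cardinal.{v}) :
    (Gr F V r r' →₀ ℤ) →ₗ[ℤ] (Quot (Adj : Gr F V r r' → Gr F V r r' → Prop) →₀ ℤ) :=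
  Finsupp.lmapDomain ℤ ℤ (Quot.mk _)

theorem ker_toComponents : LinearMap.ker (toComponents F V r r') = adjSpan F V r r' := by
  apply le_antisymm
  -- Replacing each point by the chosen representative of its component changes x only by an element
  -- of `adjSpan`.
  · have key : ∀ x : Gr F V r r' →₀ ℤ,
        x - Finsupp.mapDomain Quot.out (toComponents F V r r' x) ∈ adjSpan F V r r' := by
      intro x
      induction x using Finsupp.induction_linear with
      | zero => simp
      | add x y hx hy =>
        rw [map_add, Finsupp.mapDomain_add, add_sub_add_comm]
        exact add_mem hx hy
      | single L a =>
        have h := (adjSpan F V r r').smul_mem a (single_sub_single_mem_adjSpan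
          (Quot.eqvGen_exact (Quot.out_eq (Quot.mk Adj L))).symm)
        simpa [toComponents, smul_sub] using h
    intro x hx
    simpa [LinearMap.mem_ker.1 hx] using key x
  · rw [adjSpan, Submodule.span_le]
    rintro _ ⟨L, L', h, rfl⟩
    change toComponents F V r r' _ = 0
    rw [map_sub]
    simp [toComponents, Quot.sound h]

/-- In degree zero the coefficient at one base component is determined by the others; dropping it
identifies the quotient with the free group on the remaining components. -/
theorem free_degreeZero_quotient_adjSpan (hV : Module.rank F V = r + r') :
    Module.Free ℤ (degreeZero F V r r' ℤ ℤ ⧸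
      (adjSpan F V r r').submoduleOf (degreeZero F V r r' ℤ ℤ)) := by
  obtain ⟨L₀⟩ := nonempty hV
  let q₀ : Quot (Adj : Gr F V r r' → Gr F V r r' → Prop) := Quot.mk _ L₀
  let f : degreeZero F V r r' ℤ ℤ →ₗ[ℤ]
      ({q : Quot (Adj : Gr F V r r' → Gr F V r r' → Prop) | q ≠ q₀} →₀ ℤ) :=
    Finsupp.lsubtypeDomain {q | q ≠ q₀} ∘ₗ toComponents F V r r' ∘ₗ Submodule.subtype _
  have hker : LinearMap.ker f =
      (adjSpan F V r r').submoduleOf (degreeZero F V r r' ℤ ℤ) := by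
    ext x
    rw [Submodule.submoduleOf, Submodule.mem_comap, ← ker_toComponents, LinearMap.mem_ker, LinearMap.mem_ker]
    constructor
    · intro hx
      have hq : ∀ q ≠ q₀, toComponents F V r r' x q = 0 := fun q hq =>
        DFunLike.congr_fun hx (⟨q, hq⟩ : {q | q ≠ q₀})
      have hs : toComponents F V r r' x =
          Finsupp.single q₀ (toComponents F V r r' x q₀) := by
        ext q
        by_cases h : q = q₀
        · simp [h]
        · rw [hq q h, Finsupp.single_eq_of_ne h]
      have hdeg : ((toComponents F V r r' x).sum fun _ a => a) = 0 := by
        rw [toComponents, Finsupp.lmapDomain_apply,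
          Finsupp.sum_mapDomain_index (fun _ => rfl) (fun _ _ _ => rfl)]
        exact mem_degreeZero.1 x.2
      rw [hs, Finsupp.sum_single_index rfl] at hdeg
      rw [Submodule.subtype_apply, hs, hdeg, Finsupp.single_zero]
    · intro hx
      simp only [f, LinearMap.comp_apply, hx, map_zero]
  have hsurj : Function.Surjective f := by
    rw [← LinearMap.range_eq_top, eq_top_iff]
    rintro x -
    induction x using Finsupp.induction_linear with
    | zero => exact zero_mem _
    | add x y hx hy => exact add_mem hx hy
    | single q a =>
      obtain ⟨⟨L⟩, hq⟩ := q
      refine ⟨a • ⟨_, single_sub_single_mem_degreeZero L L₀⟩, ?_⟩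
      have hL : toComponents F V r r' (Finsupp.single L 1 - Finsupp.single L₀ 1) =
          Finsupp.single (Quot.mk Adj L) 1 - Finsupp.single q₀ 1 := by
        rw [map_sub]
        simp [toComponents, q₀]
      ext ⟨q', hq'⟩
      have h0 : Finsupp.single q₀ (1 : ℤ) q' = 0 := Finsupp.single_eq_of_ne hq'
      rw [map_smul, Finsupp.smul_apply]
      change a • toComponents F V r r' _ q' = _
      rw [Submodule.subtype_apply, hL, Finsupp.sub_apply, h0, sub_zero]
      by_cases h : q' = Quot.mk Adj L
      · subst h
        simp
      · rw [Finsupp.single_eq_of_ne h,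
          Finsupp.single_eq_of_ne fun h' => h (congrArg Subtype.val h'), smul_zero]
  exact Module.Free.of_equiv
    ((Submodule.quotEquivOfEq _ _ hker.symm).trans (f.quotKerEquivOfSurjective hsurj)).symm

theorem subsingleton_degreeZero_quotient_adjSpan_iff (hV : Module.rank F V = r + r') :
    Subsingleton (degreeZero F V r r' ℤ ℤ ⧸
      (adjSpan F V r r').submoduleOf (degreeZero F V r r' ℤ ℤ)) ↔
        r < Cardinal.aleph0 ∨ r' < Cardinal.aleph0 := by
  rw [Submodule.Quotient.subsingleton_iff, Submodule.submoduleOf_eq_top]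
  constructor
  · intro h
    by_contra! hinf
    obtain ⟨L, L', hLL'⟩ := exists_not_eqvGen_adj hinf.1 hinf.2 hV
    have := h (single_sub_single_mem_degreeZero L L')
    rw [← ker_toComponents, LinearMap.mem_ker, map_sub, sub_eq_zero] at this
    simp only [toComponents, Finsupp.lmapDomain_apply, Finsupp.mapDomain_single] at this
    exact hLL' (Quot.eqvGen_exact (Finsupp.single_left_injective one_ne_zero this))
  · intro h x hx
    obtain ⟨L₀⟩ := nonempty hV
    have key : ∀ x : Gr F V r r' →₀ ℤ,
        x - Finsupp.single L₀ (x.sum fun _ a => a) ∈ adjSpan F V r r' := by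
      intro x
      induction x using Finsupp.induction_linear with
      | zero => simp
      | add x y hx hy =>
        rw [Finsupp.sum_add_index' (fun _ => rfl) (fun _ _ _ => rfl), Finsupp.single_add,
          add_sub_add_comm]
        exact add_mem hx hy
      | single L a =>
        have h := (adjSpan F V r r').smul_mem a (single_sub_single_mem_adjSpan
          (eqvGen_adj_of_finite h L L₀))
        simpa [smul_sub] using h
    simpa [mem_degreeZero.1 hx] using key x

theorem pure_mem_of_mem_adjSpan [Ring A] {S : AddSubgroup (Gr F V r r' →₀ A)} {a : A}
    (h : ∀ L L' : Gr F V r r', Adj L L' → Finsupp.single L a - Finsupp.single L' a ∈ S)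
    {m : Gr F V r r' →₀ ℤ} (hm : m ∈ adjSpan F V r r') : pure a m ∈ S := by
  have hp : ∀ m : Gr F V r r' →₀ ℤ, pure a m =
      Finsupp.mapRange.addMonoidHom ((AddMonoidHom.flip (smulAddHom ℤ A)) a) m := fun m => rfl
  rw [hp]
  induction hm using Submodule.span_induction with
  | mem x hx =>
    obtain ⟨L, L', hL, rfl⟩ := hx
    rw [map_sub]
    simpa using h L L' hL
  | zero => rw [map_zero]; exact zero_mem _
  | add x y _ _ hx hy => rw [map_add]; exact add_mem hx hy
  | smul k x _ hx => rw [map_zsmul]; exact S.zsmul_mem hx k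

end Gr

/-! ### Assembling the theorem. -/

namespace Gr

variable {F : Type u} {V : Type v} [DivisionRing F] [AddCommGroup V] [Module F V]
  {r r' : Cardinal.{v}} {A : Type w}

theorem pure_mem_of_sum_single_mem [Infinite F] [Ring A] (hr : 1 ≤ r) (hr' : 1 ≤ r') {N : ℕ}
    (S : AddSubgroup (Gr F V r r' →₀ A)) (hS : ∀ (g : V ≃ₗ[F] V), ∀ x ∈ S, act g x ∈ S)
    {a : Fin (N + 1) → A} {L : Fin (N + 1) → Gr F V r r'}
    (hL : ¬ ((L 0).carrier : Set V) ⊆ ⋃ i : Fin N, ((L i.succ).carrier : Set V))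
    (hmem : ∑ i, Finsupp.single (L i) (a i) ∈ S) {m : Gr F V r r' →₀ ℤ}
    (hm : m ∈ adjSpan F V r r') : pure (a 0) m ∈ S := by
  obtain ⟨v, hv0, hv₀, hv⟩ : ∃ v : V, v ≠ 0 ∧ v ∈ (L 0).carrier ∧
      ∀ i ≠ 0, v ∉ (L i).carrier := by
    obtain ⟨v, hv, hv'⟩ := Set.not_subset.1 hL
    simp only [Set.mem_iUnion, not_exists, SetLike.mem_coe] at hv hv'
    have hvi : ∀ i ≠ 0, v ∉ (L i).carrier := fun i hi => by
      obtain ⟨j, rfl⟩ := Fin.exists_succ_eq.2 hi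
      exact hv' j
    -- The zero vector lies in every subspace, so v = 0 can occur only when there are no other Lᵢ;
    -- then any nonzero vector of L 0 will do.
    by_cases h0 : v = 0
    · obtain ⟨x, hx, hx0⟩ := (L 0).carrier.ne_bot_iff.1 (carrier_ne_bot hr _)
      exact ⟨x, hx0, hx, fun i hi => absurd (h0 ▸ zero_mem _) (hvi i hi)⟩
    · exact ⟨v, h0, hv, hvi⟩
  exact pure_mem_of_mem_adjSpan
    (fun K K' hK => single_sub_single_mem hr' S hS a L hmem 0 hv0 hv₀ hv hK) hm

theorem smul_pure {R : Type*} [Ring A] [Ring R] [Module R A] (b : R) (a : A)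
    (m : Gr F V r r' →₀ ℤ) : b • pure a m = pure (b • a) m := by
  ext K
  simp [pure, smul_comm]

end Gr

theorem mainTheorem2 {F : Type u} {V : Type v} [DivisionRing F] [Infinite F] [AddCommGroup V]
    [Module F V] (p : ℕ) [CharP F p] (r r' : Cardinal.{v}) (hr : 1 ≤ r) (hr' : 1 ≤ r')
    (hV : Module.rank F V = r + r') :
    ∃ (M : ℕ → Submodule ℤ (Gr F V r r' →₀ ℤ)) (hM : Antitone M),
      M 0 = Gr.degreeZero F V r r' ℤ ℤ ∧
      (∀ n, Gr.IsGStable (M n) ∧ M n ≠ ⊥) ∧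
      -- `M₀ / M₁` is free, and it vanishes iff `r` or `r'` is finite
      (Module.Free ℤ (M 0 ⧸ (M 1).submoduleOf (M 0)) ∧
        (Subsingleton (M 0 ⧸ (M 1).submoduleOf (M 0)) ↔
          r < Cardinal.aleph0 ∨ r' < Cardinal.aleph0)) ∧
      -- `ℤ[1/p] ⊗ Mₙ → ℤ[1/p] ⊗ M₁` is surjective if `p > 0`
      (0 < p → ∀ (n : ℕ) (hn : 1 ≤ n),
        Function.Surjective
          (LinearMap.lTensor (Localization.Away (p : ℤ)) (Submodule.inclusion (hM hn)))) ∧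
      -- `K ⊗ Mₙ → K ⊗ M₁` is surjective for every field `K`
      (∀ (K : Type*) [Field K] (n : ℕ) (hn : 1 ≤ n),
        Function.Surjective (LinearMap.lTensor K (Submodule.inclusion (hM hn)))) ∧
      -- submodules of `A ⊗ M₀ = A[Gr]°`, with `A` acting from the left or from the right
      (∀ N : ℕ, ∃ n : ℕ, ∀ (A : Type*) [Ring A] (a : Fin (N + 1) → A)
        (L : Fin (N + 1) → Gr F V r r'),
        ¬ ((L 0).carrier : Set V) ⊆ ⋃ i : Fin N, ((L i.succ).carrier : Set V) →
        (∀ S : Submodule A (Gr F V r r' →₀ A),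
          S ≤ Gr.degreeZero F V r r' A A → Gr.IsGStable S →
          ∑ i, Finsupp.single (L i) (a i) ∈ S →
          ∀ b : A, ∀ m ∈ M n, Gr.pure (b * a 0) m ∈ S) ∧
        (∀ S : Submodule Aᵐᵒᵖ (Gr F V r r' →₀ A),
          S ≤ Gr.degreeZero F V r r' Aᵐᵒᵖ A → Gr.IsGStable S →
          ∑ i, Finsupp.single (L i) (a i) ∈ S →
          ∀ b : A, ∀ m ∈ M n, Gr.pure (a 0 * b) m ∈ S)) := by
  obtain ⟨M, hM₀, hM₁⟩ : ∃ M : ℕ → Submodule ℤ (Gr F V r r' →₀ ℤ),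
      M 0 = Gr.degreeZero F V r r' ℤ ℤ ∧ ∀ n, M (n + 1) = Gr.adjSpan F V r r' :=
    ⟨fun n => n.casesOn (Gr.degreeZero F V r r' ℤ ℤ) fun _ => Gr.adjSpan F V r r',
      rfl, fun _ => rfl⟩
  have hM : Antitone M := antitone_nat_of_succ_le fun n => by
    cases n
    · rw [hM₀, hM₁]
      exact Gr.adjSpan_le_degreeZero
    · rw [hM₁, hM₁]
  have hsurj : ∀ (n : ℕ) (hn : 1 ≤ n), Function.Surjective (Submodule.inclusion (hM hn)) := by
    intro n hn x
    obtain ⟨k, rfl⟩ := Nat.exists_eq_add_of_le' hn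
    exact ⟨⟨x, ((hM₁ 0).trans (hM₁ k).symm).le x.2⟩, rfl⟩
  have hbot := Gr.adjSpan_ne_bot (F := F) (V := V) hr hr' hV
  refine ⟨M, hM, hM₀, fun n => ?_, ?_,
    fun _ n hn => LinearMap.lTensor_surjective _ (hsurj n hn),
    fun K _ n hn => LinearMap.lTensor_surjective _ (hsurj n hn),
    fun N => ⟨1, fun A _ a L hL => ⟨fun S _ hS hmem b m hm => ?_, fun S _ hS hmem b m hm => ?_⟩⟩⟩
  · cases n
    · rw [hM₀]
      exact ⟨Gr.isGStable_degreeZero, ne_bot_of_le_ne_bot hbot Gr.adjSpan_le_degreeZero⟩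
    · rw [hM₁]
      exact ⟨Gr.isGStable_adjSpan, hbot⟩
  · rw [hM₀, hM₁ 0]
    exact ⟨Gr.free_degreeZero_quotient_adjSpan hV,
      Gr.subsingleton_degreeZero_quotient_adjSpan_iff hV⟩
  · rw [hM₁ 0] at hm
    -- The extraction needs only the additive group of S; the scalar b enters afterwards, from the
    -- left here and through `Aᵐᵒᵖ` in the right-handed case.
    have := S.smul_mem b (Gr.pure_mem_of_sum_single_mem hr hr' S.toAddSubgroup hS hL hmem hm)
    rwa [Gr.smul_pure] at this
  · rw [hM₁ 0] at hm
    have := S.smul_mem (MulOpposite.op b)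
      (Gr.pure_mem_of_sum_single_mem hr hr' S.toAddSubgroup hS hL hmem hm)
    rwa [Gr.smul_pure] at this
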